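/- Let $K$ be a field of characteristic $0$ and let $n\ge 3$. All algebras are associative with unit. Put $[a_1,a_2]=a_1a_2-a_2a_1$ and $[a_1,\dots,a_m]=[[a_1,\dots,a_{m-1}],a_m]$. For an algebra $A$ and $m\ge 2$ let $T^{(m)}(A)$ be the two-sided ideal of $A$ generated by all elements $[a_1,\dots,a_m]$ with $a_1,\dots,a_m\in A$, and let $Z(A)$ be the center of $A$. Let $F$ be the free associative $K$-algebra on the free generators $x_1,x_2,\dots$, let $F^{(n)}=F/T^{(n)}(F)$, and let $F_r^{(n)}$ be the unital subalgebra of $F^{(n)}$ generated by the images of $x_1,\dots,x_r$. **Theorem 3.** For $r=2,3$ the center of $F_r^{(n)}$ equals, up to scalars, $T^{(n-1)}(F_r^{(n)})$; precisely, $$Z(F_r^{(n)})=K\cdot 1\oplus T^{(n-1)}(F_r^{(n)}).$$ In particular, every central element of $F_r^{(n)}$ with zero constant term (that is, lying in the ideal generated by $x_1,\dots,x_r$) is nuclear, i.e. the two-sided ideal of $F_r^{(n)}$ that it generates is contained in $Z(F_r^{(n)})$. -/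

import Mathlib

/-- The left-normed commutator `[a₁, …, aₙ]` of the first `n` entries of a sequence (whose entries are
numbered from `0`): `[a₁] = a₁` and `[a₁, …, aₙ] = [[a₁, …, aₙ₋₁], aₙ]`, where `⁅u, v⁆ = u * v - v * u`.
The value for `n = 0` is a convention and is never used. -/
def longComm {A : Type*} [Ring A] (a : ℕ → A) : ℕ → A
  | 0 => 0
  | 1 => a 0
  | (k + 2) => ⁅longComm a (k + 1), a (k + 1)⁆

/-- The T-ideal `T⁽ⁿ⁾(A)` of an algebra `A` generated by the commutator of degree `n`: the two-sided
ideal generated by all values `[a₁, …, aₙ]` with `aᵢ ∈ A`. -/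
def tIdeal (A : Type*) [Ring A] (n : ℕ) : TwoSidedIdeal A :=
  TwoSidedIdeal.span {c : A | ∃ a : ℕ → A, c = longComm a n}

/-- The relatively free algebra `F⁽ⁿ⁾ = F / T⁽ⁿ⁾(F)`, where `F` is the free associative unital
`K`-algebra on countably many generators. -/
abbrev RelFree (K : Type*) [Field K] (n : ℕ) : Type _ :=
  (tIdeal (FreeAlgebra K ℕ) n).ringCon.Quotient

/-- The image in `F⁽ⁿ⁾` of the `i`-th free generator (numbered from `0`). -/
def relFreeGen (K : Type*) [Field K] (n : ℕ) (i : ℕ) : RelFree K n :=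
  (tIdeal (FreeAlgebra K ℕ) n).ringCon.mk' (FreeAlgebra.ι K i)

/-- The algebra `F_r⁽ⁿ⁾` of rank `r`: the unital subalgebra of `F⁽ⁿ⁾` generated by the first `r`
generators. -/
def relFreeRank (K : Type*) [Field K] (n r : ℕ) : Subalgebra K (RelFree K n) :=
  Algebra.adjoin K {u | ∃ i < r, u = relFreeGen K n i}

/-- The ideal of the elements of `F_r⁽ⁿ⁾` with zero constant term: the two-sided ideal generated by
the first `r` generators. -/
def zeroConstIdeal (K : Type*) [Field K] (n r : ℕ) : TwoSidedIdeal (relFreeRank K n r) :=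
  TwoSidedIdeal.span {u | ∃ i < r, (u : RelFree K n) = relFreeGen K n i}

/-- An element of an algebra is nuclear if the two-sided ideal it generates is contained in the
center. -/
def IsNuclear (K : Type*) {A : Type*} [Field K] [Ring A] [Algebra K A] (a : A) : Prop :=
  ∀ b ∈ TwoSidedIdeal.span {a}, b ∈ Subalgebra.center K A

/-! Let `F` be free of rank two or three, and give a Lie monomial weight degree minus one. Two facts
about the span of products of Lie monomials of total weight at least `k` settle the theorem.

It is `T⁽ᵏ⁺¹⁾`. One inclusion holds in every rank. For the other, `⁅p * ⁅q, s⁆, t⁆` modulo triple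
commutators is alternating and satisfies a Leibniz rule; with at most three generators this forces
it to vanish (`fourForm_eq_zero`). Hence `T⁽ᵏ⁺¹⁾` brackets into `T⁽ᵏ⁺²⁾` (`lie_mem_tIdeal`), so
`T⁽ⁿ⁻¹⁾` is central modulo `T⁽ⁿ⁾`, and products of Lie monomials lie in the expected `T`-ideal
(`commSpan_mul_mem_tIdeal`).

The filtration splits. Coproduct followed by multiplication, rescaled by degree, acts on weight `w`
by `2⁻ʷ` up to higher weight, so `F` is a sum of eigenspaces, and bracketing with a generator raises
the weight by exactly one (`adams_lie_ι`). If all `⁅f, xₖ⁆` have weight at least `m + 1`, the part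
of `f` of weight below `m` commutes with every generator, so it is a scalar
(`exists_sub_algebraMap_mem_wtFiltration`). With `m = n - 2` this bounds the center. -/

section Generic

/-! ### Spans of long commutators and T-ideals in general algebras -/

variable (K : Type*) {A B : Type*} [Field K] [Ring A] [Algebra K A] [Ring B]

theorem longComm_congr {a b : ℕ → A} : ∀ {n : ℕ}, (∀ i < n, a i = b i) → longComm a n = longComm b n
  | 0, _ => rfl
  | 1, h => h 0 one_pos
  | k + 2, h => by
    rw [longComm, longComm, longComm_congr (n := k + 1) fun i hi => h i (by omega),
      h (k + 1) (by omega)]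

theorem map_longComm (φ : A →+* B) (a : ℕ → A) :
    ∀ n : ℕ, φ (longComm a n) = longComm (fun i => φ (a i)) n
  | 0 => map_zero φ
  | 1 => rfl
  | k + 2 => by
    simp only [longComm, Ring.lie_def, map_sub, map_mul, map_longComm φ a (k + 1)]

/-- Iterating a bracket: the first entry of a commutator of length `k + 1` may itself be a
commutator of length two. -/
theorem longComm_succ_eq (a : ℕ → A) : ∀ k : ℕ,
    longComm a (k + 2) = longComm (fun i => if i = 0 then ⁅a 0, a 1⁆ else a (i + 1)) (k + 1)
  | 0 => rfl
  | k + 1 => by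
    rw [longComm, longComm_succ_eq a k]
    simp [longComm]

variable (A) in
/-- The linear span of the commutators of length `n`. -/
def commSpan (n : ℕ) : Submodule K A :=
  Submodule.span K {c : A | ∃ a : ℕ → A, c = longComm a n}

/-- The linear map `u ↦ ⁅u, b⁆`. -/
def lieRight (b : A) : A →ₗ[K] A := LinearMap.mulRight K b - LinearMap.mulLeft K b

theorem lieRight_apply (b u : A) : lieRight K b u = ⁅u, b⁆ := rfl

/-- The linear map `v ↦ ⁅u, v⁆`. -/
def lieLeft (u : A) : A →ₗ[K] A := LinearMap.mulLeft K u - LinearMap.mulRight K u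

theorem lieLeft_apply (u v : A) : lieLeft K u v = ⁅u, v⁆ := rfl

variable {K}

theorem commSpan_one : commSpan K A 1 = ⊤ := by
  rw [eq_top_iff]
  exact fun x _ => Submodule.subset_span ⟨fun _ => x, rfl⟩

theorem lie_mem_commSpan {k : ℕ} {u : A} (hu : u ∈ commSpan K A (k + 1)) (b : A) :
    ⁅u, b⁆ ∈ commSpan K A (k + 2) := by
  induction hu using Submodule.span_induction with
  | mem x hx =>
    obtain ⟨a, rfl⟩ := hx
    refine Submodule.subset_span ⟨Function.update a (k + 1) b, ?_⟩
    rw [longComm, Function.update_self,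
      longComm_congr (a := Function.update a (k + 1) b) (b := a) fun i hi =>
        Function.update_of_ne (by omega) _ _]
  | zero => simp [Ring.lie_def]
  | add x y _ _ hx hy => rw [← lieRight_apply K, map_add]; exact add_mem hx hy
  | smul c x _ hx => rw [← lieRight_apply K, map_smul]; exact Submodule.smul_mem _ _ hx

theorem commSpan_le_of_lie {k : ℕ} {p : Submodule K A}
    (h : ∀ u ∈ commSpan K A (k + 1), ∀ b : A, ⁅u, b⁆ ∈ p) : commSpan K A (k + 2) ≤ p :=
  Submodule.span_le.2 fun _ ⟨a, ha⟩ =>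
    ha ▸ h _ (Submodule.subset_span ⟨a, rfl⟩) (a (k + 1))

theorem lie_mem_commSpan_two (a b : A) : ⁅a, b⁆ ∈ commSpan K A 2 :=
  lie_mem_commSpan (k := 0) (by simp [commSpan_one]) b

theorem ring_lie_lie (u v w : B) : ⁅u, ⁅v, w⁆⁆ = ⁅⁅u, v⁆, w⁆ - ⁅⁅u, w⁆, v⁆ := by
  simp only [Ring.lie_def]; noncomm_ring

/-- Induction on the length of the right entry: the Jacobi identity shortens it while lengthening
the left one. -/
theorem lie_commSpan_mem {a : ℕ} : ∀ (b : ℕ) {u v : A}, u ∈ commSpan K A (a + 1) →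
    v ∈ commSpan K A (b + 1) → ⁅u, v⁆ ∈ commSpan K A (a + b + 2)
  | 0, _, _, hu, _ => lie_mem_commSpan hu _
  | b + 1, u, v, hu, hv => by
    have : commSpan K A (b + 2) ≤ (commSpan K A (a + (b + 1) + 2)).comap
        (lieLeft K u) := by
      refine commSpan_le_of_lie fun v' hv' c => ?_
      rw [Submodule.mem_comap, lieLeft_apply, ring_lie_lie]
      refine sub_mem (lie_mem_commSpan (k := a + b + 1) (lie_commSpan_mem b hu hv') c) ?_
      · have := lie_commSpan_mem b (lie_mem_commSpan hu c) hv'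
        rwa [show a + 1 + b + 2 = a + (b + 1) + 2 by ring] at this
    exact this hv

theorem longComm_mem_tIdeal (a : ℕ → A) (n : ℕ) : longComm a n ∈ tIdeal A n :=
  TwoSidedIdeal.subset_span ⟨a, rfl⟩

theorem smul_mem_tIdeal {I : TwoSidedIdeal A} (c : K) {x : A} (hx : x ∈ I) : c • x ∈ I := by
  rw [Algebra.smul_def]; exact I.mul_mem_left _ _ hx

theorem mem_tIdeal_of_mem_commSpan {n : ℕ} {x : A} (hx : x ∈ commSpan K A n) : x ∈ tIdeal A n := by
  induction hx using Submodule.span_induction with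
  | mem x hx => exact TwoSidedIdeal.subset_span hx
  | zero => exact zero_mem _
  | add x y _ _ hx hy => exact add_mem hx hy
  | smul c x _ hx => exact smul_mem_tIdeal c hx

theorem tIdeal_le {n : ℕ} {I : TwoSidedIdeal B} (h : ∀ a : ℕ → B, longComm a n ∈ I) :
    tIdeal B n ≤ I :=
  TwoSidedIdeal.span_le.2 fun _ ⟨a, ha⟩ => ha ▸ h a

theorem tIdeal_succ_le (k : ℕ) : tIdeal A (k + 2) ≤ tIdeal A (k + 1) :=
  tIdeal_le fun a => by rw [longComm_succ_eq]; exact TwoSidedIdeal.subset_span ⟨_, rfl⟩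

theorem map_mem_tIdeal (φ : A →+* B) {n : ℕ} {x : A} (hx : x ∈ tIdeal A n) :
    φ x ∈ tIdeal B n := by
  have : tIdeal A n ≤ (tIdeal B n).comap φ := tIdeal_le fun a => by
    rw [TwoSidedIdeal.mem_comap, map_longComm]
    exact TwoSidedIdeal.subset_span ⟨_, rfl⟩
  exact (TwoSidedIdeal.mem_comap φ).1 (this hx)

theorem exists_mem_tIdeal_of_surjective {φ : A →+* B} (hφ : Function.Surjective φ) {n : ℕ} {y : B}
    (hy : y ∈ tIdeal B n) : ∃ x ∈ tIdeal A n, φ x = y := by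
  induction hy using TwoSidedIdeal.span_induction with
  | mem y hy =>
    obtain ⟨b, rfl⟩ := hy
    choose a ha using fun i => hφ (b i)
    exact ⟨longComm a n, longComm_mem_tIdeal a n, by rw [map_longComm]; simp only [ha]⟩
  | zero => exact ⟨0, zero_mem _, map_zero φ⟩
  | add y z _ _ hy hz =>
    obtain ⟨x, hx, rfl⟩ := hy
    obtain ⟨w, hw, rfl⟩ := hz
    exact ⟨x + w, add_mem hx hw, map_add φ x w⟩
  | neg y _ hy =>
    obtain ⟨x, hx, rfl⟩ := hy
    exact ⟨-x, neg_mem hx, map_neg φ x⟩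
  | left_absorb b y _ hy =>
    obtain ⟨x, hx, rfl⟩ := hy
    obtain ⟨a, rfl⟩ := hφ b
    exact ⟨a * x, (tIdeal A n).mul_mem_left _ _ hx, map_mul φ a x⟩
  | right_absorb b y _ hy =>
    obtain ⟨x, hx, rfl⟩ := hy
    obtain ⟨a, rfl⟩ := hφ b
    exact ⟨x * a, (tIdeal A n).mul_mem_right _ _ hx, map_mul φ x a⟩

end Generic

/-! ### The alternating form `⁅p * ⁅q, s⁆, t⁆` modulo triple commutators -/

section FourForm

variable (K : Type*) {A : Type*} [Field K] [Ring A] [Algebra K A]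

/-- The class of `⁅p * ⁅q, s⁆, t⁆` modulo the span of the commutators of length three, as a linear
function of `p`. -/
def fourForm (q s t : A) : A →ₗ[K] A ⧸ commSpan K A 3 :=
  (commSpan K A 3).mkQ ∘ₗ lieRight K t ∘ₗ LinearMap.mulRight K ⁅q, s⁆

variable {K}

theorem fourForm_apply (q s t p : A) :
    fourForm K q s t p = Submodule.Quotient.mk ⁅p * ⁅q, s⁆, t⁆ := rfl

theorem lie_lie_mem_commSpan (a b c : A) : ⁅⁅a, b⁆, c⁆ ∈ commSpan K A 3 :=
  lie_mem_commSpan (lie_mem_commSpan_two a b) c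

/-- Expand `⁅⁅p * q, s⁆, t⁆` by Leibniz; reordering one product costs only a triple commutator.
Together with the swaps 2-3 and 1-4 this generates all permutations, so the form is antisymmetric.
-/
theorem fourForm_swap₁₂ (p q s t : A) : fourForm K q s t p = -fourForm K p s t q := by
  rw [eq_neg_iff_add_eq_zero, fourForm_apply, fourForm_apply, ← Submodule.Quotient.mk_add,
    Submodule.Quotient.mk_eq_zero]
  convert sub_mem (lie_lie_mem_commSpan (K := K) (p * q) s t)
    (lie_lie_mem_commSpan (K := K) ⁅p, s⁆ q t) using 1
  simp only [Ring.lie_def]; noncomm_ring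

theorem fourForm_swap₂₃ (p q s t : A) : fourForm K q s t p = -fourForm K s q t p := by
  rw [fourForm_apply, fourForm_apply, ← Submodule.Quotient.mk_neg]
  congr 1
  simp only [Ring.lie_def]; noncomm_ring

theorem fourForm_swap₁₄ (p q s t : A) : fourForm K q s t p = -fourForm K q s p t := by
  rw [eq_neg_iff_add_eq_zero, fourForm_apply, fourForm_apply, ← Submodule.Quotient.mk_add,
    Submodule.Quotient.mk_eq_zero]
  convert sub_mem (lie_lie_mem_commSpan (K := K) q s (t * p))
    (lie_lie_mem_commSpan (K := K) ⁅q, s⁆ t p) using 1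
  simp only [Ring.lie_def]; noncomm_ring

theorem fourForm_swap₂₄ (p q s t : A) : fourForm K q s t p = -fourForm K t s q p := by
  rw [fourForm_swap₁₂, fourForm_swap₁₄, fourForm_swap₁₂, neg_neg]

theorem fourForm_swap₃₄ (p q s t : A) : fourForm K q s t p = -fourForm K q t s p := by
  rw [fourForm_swap₂₃, fourForm_swap₂₄, fourForm_swap₂₃, neg_neg]

theorem fourForm_mul (p q s t t' : A) :
    fourForm K q s (t * t') p = fourForm K q s t' (t * p) + fourForm K q s t (t' * p) := by
  rw [← sub_eq_zero]
  simp only [fourForm_apply, ← Submodule.Quotient.mk_add, ← Submodule.Quotient.mk_sub,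
    Submodule.Quotient.mk_eq_zero]
  convert lie_lie_mem_commSpan (K := K) (p * ⁅q, s⁆) t t' using 1
  simp only [Ring.lie_def]; noncomm_ring

/-- Moved into the last slot, a product expands by `fourForm_mul` into an expression symmetric in
its factors. -/
theorem fourForm_mul_comm (a b q s t : A) :
    fourForm K q s t (a * b) = fourForm K q s t (b * a) := by
  rw [fourForm_swap₁₄, fourForm_mul, fourForm_swap₁₄ (b * a), fourForm_mul, add_comm]

theorem fourForm_one (q s t : A) : fourForm K q s t 1 = 0 := by
  rw [fourForm_apply, Submodule.Quotient.mk_eq_zero, one_mul]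
  exact lie_lie_mem_commSpan q s t

/-- Compare the two expansions of the last slot given by `t₁ * (t₂ * t₃) = (t₁ * t₂) * t₃`. -/
theorem fourForm_lie_mul_swap (p q s t₁ t₂ t₃ : A) :
    fourForm K q s t₃ (⁅t₁, t₂⁆ * p) = -fourForm K q s t₂ (⁅t₁, t₃⁆ * p) := by
  have h₁ := fourForm_mul (K := K) p q s t₁ (t₂ * t₃)
  have h₂ := fourForm_mul (K := K) p q s (t₁ * t₂) t₃
  rw [fourForm_mul (t₁ * p)] at h₁
  rw [fourForm_mul (t₃ * p)] at h₂
  rw [mul_assoc t₁, h₁] at h₂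
  simp only [Ring.lie_def, sub_mul, map_sub, ← mul_assoc] at h₂ ⊢
  rw [← sub_eq_zero] at h₂ ⊢
  rw [← neg_eq_zero, ← h₂]
  abel

variable (K) in
/-- The class of `⁅⁅t₁, t₂⁆ * p * ⁅q, s⁆, t₃⁆` modulo commutators of length three, as a linear
function of `t₁`. -/
def fiveForm (s p t₂ t₃ q : A) : A →ₗ[K] A ⧸ commSpan K A 3 :=
  fourForm K q s t₃ ∘ₗ LinearMap.mulRight K p ∘ₗ lieRight K t₂

theorem fiveForm_apply (s p t₁ t₂ t₃ q : A) :
    fiveForm K s p t₂ t₃ q t₁ = fourForm K q s t₃ (⁅t₁, t₂⁆ * p) := rfl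

theorem fiveForm_swap₁₂ (s p t₁ t₂ t₃ q : A) :
    fiveForm K s p t₂ t₃ q t₁ = -fiveForm K s p t₁ t₃ q t₂ := by
  rw [fiveForm_apply, fiveForm_apply, ← map_neg]
  congr 1
  simp only [Ring.lie_def]; noncomm_ring

theorem fiveForm_swap₂₃ (s p t₁ t₂ t₃ q : A) :
    fiveForm K s p t₂ t₃ q t₁ = -fiveForm K s p t₃ t₂ q t₁ :=
  fourForm_lie_mul_swap p q s t₁ t₂ t₃

theorem fiveForm_swap₃₄ (s p t₁ t₂ t₃ q : A) :
    fiveForm K s p t₂ t₃ q t₁ = -fiveForm K s p t₂ q t₃ t₁ :=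
  fourForm_swap₂₄ _ _ _ _

theorem fiveForm_mul (s p t t' t₂ t₃ q : A) :
    fiveForm K s p t₂ t₃ q (t * t') =
      fiveForm K s (p * t) t₂ t₃ q t' + fiveForm K s (t' * p) t₂ t₃ q t := by
  simp only [fiveForm_apply]
  rw [← mul_assoc, fourForm_mul_comm _ t, ← map_add]
  congr 1
  simp only [Ring.lie_def]; noncomm_ring

end FourForm

/-! ### Vanishing of the form on at most three generators -/

section RankThree

open FreeAlgebra

variable {K : Type*} [Field K] {X : Type*}

/-- The Leibniz rule alters the coefficient `p`, so the induction must run over all `p` at once.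
Constants die because `hmul` at `1 * 1` gives `φ p 1 = 0`. -/
theorem eq_zero_of_derivation {V : Type*} [AddCommGroup V] [Module K V]
    (φ : FreeAlgebra K X → FreeAlgebra K X →ₗ[K] V)
    (hmul : ∀ p t t', φ p (t * t') = φ (p * t) t' + φ (t' * p) t)
    (hgen : ∀ p i, φ p (ι K i) = 0) (p t : FreeAlgebra K X) : φ p t = 0 := by
  induction t using FreeAlgebra.induction generalizing p with
  | grade0 c =>
    have h := hmul p 1 1
    rw [mul_one, mul_one, one_mul, left_eq_add] at h
    rw [Algebra.algebraMap_eq_smul_one, map_smul, h, smul_zero]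
  | grade1 i => exact hgen p i
  | mul a b ha hb => rw [hmul, ha, hb, add_zero]
  | add a b ha hb => rw [map_add, ha, hb, add_zero]

theorem basisFreeMonoid_apply (w : FreeMonoid X) :
    basisFreeMonoid K X w = (w.toList.map (ι K)).prod := by
  simp [basisFreeMonoid, equivMonoidAlgebraFreeMonoid, FreeMonoid.lift_apply]

theorem mem_span_words (p : FreeAlgebra K X) :
    p ∈ Submodule.span K (Set.range fun w : List X => (w.map (ι K)).prod) := by
  refine Submodule.span_mono ?_ ((basisFreeMonoid K X).mem_span p)
  rintro _ ⟨w, rfl⟩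
  exact ⟨w.toList, (basisFreeMonoid_apply w).symm⟩

/-- Among four elements of `X` two are equal. -/
def CardLeThree (X : Type*) : Prop :=
  ∀ i j k l : X, i = j ∨ i = k ∨ i = l ∨ j = k ∨ j = l ∨ k = l

variable [CharZero K]

theorem eq_zero_of_eq_neg {V : Type*} [AddCommGroup V] [Module K V] {v : V} (h : v = -v) :
    v = 0 := by
  have : (2 : K) • v = 0 := by rw [two_smul]; nth_rewrite 1 [h]; simp
  simpa using this

theorem fiveForm_gen (hX : CardLeThree X) (s p : FreeAlgebra K X) (i j k l : X) :
    fiveForm K s p (ι K j) (ι K k) (ι K l) (ι K i) = 0 := by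
  have key : ∀ (a b c : FreeAlgebra K X), fiveForm K s p a b c a = 0 := fun a b c =>
    eq_zero_of_eq_neg (K := K) (fiveForm_swap₁₂ s p a a b c)
  have key₂ : ∀ (a b c : FreeAlgebra K X), fiveForm K s p b b c a = 0 := fun a b c =>
    eq_zero_of_eq_neg (K := K) (fiveForm_swap₂₃ s p a b b c)
  have key₃ : ∀ (a b c : FreeAlgebra K X), fiveForm K s p b c c a = 0 := fun a b c =>
    eq_zero_of_eq_neg (K := K) (fiveForm_swap₃₄ s p a b c c)
  rcases hX i j k l with rfl | rfl | rfl | rfl | rfl | rfl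
  · exact key _ _ _
  · rw [fiveForm_swap₂₃, key, neg_zero]
  · rw [fiveForm_swap₃₄, fiveForm_swap₂₃, key, neg_zero, neg_zero]
  · exact key₂ _ _ _
  · rw [fiveForm_swap₃₄, key₂, neg_zero]
  · exact key₃ _ _ _

/-- Antisymmetry carries each of four slots in turn to the derivation slot, reducing all of them to
generators, two of which coincide. -/
theorem fiveForm_eq_zero (hX : CardLeThree X) (s p t₁ t₂ t₃ q : FreeAlgebra K X) :
    fiveForm K s p t₂ t₃ q t₁ = 0 := by
  have h₁ : ∀ j k l p t₁, fiveForm K s p (ι K j) (ι K k) (ι K l) t₁ = 0 := fun j k l =>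
    eq_zero_of_derivation _ (fun p t t' => fiveForm_mul s p t t' _ _ _)
      fun p i => fiveForm_gen hX s p i j k l
  have h₂ : ∀ t₁ k l p t₂, fiveForm K s p t₁ (ι K k) (ι K l) t₂ = 0 := fun t₁ k l =>
    eq_zero_of_derivation _ (fun p t t' => fiveForm_mul s p t t' _ _ _)
      fun p j => by rw [fiveForm_swap₁₂, h₁, neg_zero]
  have h₃ : ∀ t₁ t₂ l p t₃, fiveForm K s p t₁ t₂ (ι K l) t₃ = 0 := fun t₁ t₂ l =>
    eq_zero_of_derivation _ (fun p t t' => fiveForm_mul s p t t' _ _ _)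
      fun p k => by rw [fiveForm_swap₁₂, fiveForm_swap₂₃, h₂, neg_zero, neg_zero]
  exact eq_zero_of_derivation (fun p => fiveForm K s p t₂ t₃ q)
    (fun p t t' => fiveForm_mul s p t t' _ _ _)
    (fun p l => by
      rw [fiveForm_swap₁₂, fiveForm_swap₂₃, fiveForm_swap₃₄, h₃, neg_zero, neg_zero, neg_zero])
    p t₁

theorem fourForm_mul_mul_comm (hX : CardLeThree X) (a b c q s t : FreeAlgebra K X) :
    fourForm K q s t (a * (b * c)) = fourForm K q s t (a * (c * b)) := by
  rw [fourForm_mul_comm a, fourForm_mul_comm a, ← sub_eq_zero, ← map_sub, ← sub_mul]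
  exact fiveForm_eq_zero hX s a b c t q

/-- Coefficients now commute, so the form acts as a derivation on the word. A letter `j` or `k`
repeats an argument and contributes zero; each letter `i` contributes the same term. -/
theorem fourForm_gen_word (hX : CardLeThree X) {i j k : X}
    (h : ∀ l, l = i ∨ l = j ∨ l = k) (hij : j ≠ i) (hik : k ≠ i) (w : List X) (q : FreeAlgebra K X) [DecidableEq X] :
    fourForm K (ι K j) (ι K k) (w.map (ι K)).prod (q * ι K i) =
      (w.count i : K) • fourForm K (ι K j) (ι K k) (ι K i) (q * (w.map (ι K)).prod) := by
  induction w generalizing q with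
  | nil =>
    rw [fourForm_swap₁₄]
    simp [fourForm_one]
  | cons l w ih =>
    rw [List.map_cons, List.prod_cons, fourForm_mul, fourForm_mul_comm (ι K l), mul_assoc,
      fourForm_mul_mul_comm hX, ← mul_assoc, ih, mul_assoc]
    rcases h l with rfl | rfl | rfl
    · rw [fourForm_mul_comm (List.prod _), mul_assoc, List.count_cons_self]
      push_cast
      rw [add_smul, one_smul]
    · rw [eq_zero_of_eq_neg (K := K) (fourForm_swap₂₄ _ (ι K l) (ι K k) (ι K l)), add_zero,
        List.count_cons_of_ne hij]
    · rw [eq_zero_of_eq_neg (K := K) (fourForm_swap₃₄ _ (ι K j) (ι K l) (ι K l)), add_zero,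
        List.count_cons_of_ne hik]

theorem fourForm_gen (hX : CardLeThree X) (p : FreeAlgebra K X) (i j k : X) :
    fourForm K (ι K j) (ι K k) (ι K i) p = 0 := by
  classical
  by_cases hjk : j = k
  · subst hjk
    exact eq_zero_of_eq_neg (K := K) (fourForm_swap₂₃ p _ _ _)
  by_cases hji : j = i
  · subst hji
    exact eq_zero_of_eq_neg (K := K) (fourForm_swap₂₄ p _ _ _)
  by_cases hki : k = i
  · subst hki
    exact eq_zero_of_eq_neg (K := K) (fourForm_swap₃₄ p _ _ _)
  have h : ∀ l, l = i ∨ l = j ∨ l = k := fun l => by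
    have := hX i j k l; grind
  have hword : ∀ w : List X, fourForm K (ι K j) (ι K k) (ι K i) (w.map (ι K)).prod = 0 := by
    intro w
    -- Expanding the zero value at coefficient `1` and last entry `xᵢ * w` gives `count + 1` copies
    -- of the desired value; characteristic zero finishes.
    have h₀ := fourForm_one (K := K) (ι K j) (ι K k) (ι K i * (w.map (ι K)).prod)
    have h₁ := fourForm_gen_word hX h hji hki w (1 : FreeAlgebra K X)
    rw [fourForm_mul, mul_one, mul_one, ← one_mul (ι K i), h₁, one_mul, one_mul] at h₀
    have h₂ : ((w.count i : K) + 1) • fourForm K (ι K j) (ι K k) (ι K i) (w.map (ι K)).prod = 0 := by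
      rw [add_smul, one_smul, h₀]
    exact (smul_eq_zero.1 h₂).resolve_left (Nat.cast_add_one_ne_zero _)
  refine Submodule.span_induction ?_ (map_zero _) (fun x y _ _ hx hy => ?_) (fun c x _ hx => ?_)
    (mem_span_words p)
  · rintro _ ⟨w, rfl⟩
    exact hword w
  · rw [map_add, hx, hy, add_zero]
  · rw [map_smul, hx, smul_zero]

theorem fourForm_eq_zero (hX : CardLeThree X) (p q s t : FreeAlgebra K X) :
    fourForm K q s t p = 0 := by
  have hm : ∀ q s p t t' : FreeAlgebra K X,
      fourForm K q s p (t * t') = fourForm K q s (p * t) t' + fourForm K q s (t' * p) t :=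
    fun q s p t t' => by
      rw [fourForm_swap₁₄, fourForm_mul, fourForm_mul_comm t, neg_add, ← fourForm_swap₁₄,
        ← fourForm_swap₁₄]
  have h₁ : ∀ j k p t, fourForm K (ι K j) (ι K k) p t = 0 := fun j k =>
    eq_zero_of_derivation _ (hm _ _) fun p i => by rw [fourForm_swap₁₄, fourForm_gen hX, neg_zero]
  have h₂ : ∀ j s p t, fourForm K (ι K j) s p t = 0 := fun j s =>
    eq_zero_of_derivation _ (hm _ _) fun p i => by
      rw [fourForm_swap₁₄, fourForm_swap₃₄, fourForm_swap₁₄, h₁, neg_zero, neg_zero, neg_zero]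
  exact eq_zero_of_derivation _ (hm q s) (fun p i => by
    rw [fourForm_swap₁₄, fourForm_swap₂₄, fourForm_swap₁₄, h₂, neg_zero, neg_zero, neg_zero]) t p

theorem lie_mul_lie_mem_commSpan (hX : CardLeThree X) (p q s t : FreeAlgebra K X) :
    ⁅p * ⁅q, s⁆, t⁆ ∈ commSpan K (FreeAlgebra K X) 3 :=
  (Submodule.Quotient.mk_eq_zero _).1 (fourForm_eq_zero hX p q s t)

end RankThree

/-! ### Products and brackets of T-ideals in rank at most three -/

section RankThreeIdeals

variable {K : Type*} [Field K] {X : Type*}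

variable (K) in
/-- The ideal `T⁽ⁿ⁾` as a linear subspace. -/
def tSubmodule (A : Type*) [Ring A] [Algebra K A] (n : ℕ) : Submodule K A where
  carrier := {x | x ∈ tIdeal A n}
  add_mem' := (tIdeal A n).add_mem
  zero_mem' := (tIdeal A n).zero_mem
  smul_mem' c _ hx := smul_mem_tIdeal (I := tIdeal A n) c hx

theorem mem_tSubmodule {A : Type*} [Ring A] [Algebra K A] {n : ℕ} {x : A} :
    x ∈ tSubmodule K A n ↔ x ∈ tIdeal A n := Iff.rfl

theorem mem_tIdeal_one {A : Type*} [Ring A] (x : A) : x ∈ tIdeal A 1 :=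
  longComm_mem_tIdeal (fun _ => x) 1

theorem lie_mem_tIdeal_two {A : Type*} [Ring A] (x y : A) : ⁅x, y⁆ ∈ tIdeal A 2 :=
  longComm_mem_tIdeal (fun i => if i = 0 then x else y) 2

variable [CharZero K]

theorem lie_mul_lie_commSpan (hX : CardLeThree X) :
    ∀ (j : ℕ) {l : FreeAlgebra K X}, l ∈ commSpan K (FreeAlgebra K X) (j + 1) →
      ∀ p q s : FreeAlgebra K X, ⁅p * ⁅q, s⁆, l⁆ ∈ commSpan K (FreeAlgebra K X) (j + 3)
  | 0, l, _, p, q, s => lie_mul_lie_mem_commSpan hX p q s l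
  | j + 1, l, hl, p, q, s => by
    have : commSpan K (FreeAlgebra K X) (j + 2) ≤
        (commSpan K (FreeAlgebra K X) (j + 4)).comap (lieLeft K (p * ⁅q, s⁆)) := by
      refine commSpan_le_of_lie fun l hl a => ?_
      rw [Submodule.mem_comap, lieLeft_apply, ring_lie_lie]
      refine sub_mem (lie_mem_commSpan (lie_mul_lie_commSpan hX j hl p q s) a) ?_
      have := lie_commSpan_mem (a := 2) j (lie_mul_lie_mem_commSpan hX p q s a) hl
      rwa [show 2 + j + 2 = j + 4 by ring] at this
    exact this hl

theorem lie_mul_mem_of_mem_commSpan (hX : CardLeThree X) {k : ℕ} {v : FreeAlgebra K X}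
    (hv : v ∈ commSpan K (FreeAlgebra K X) (k + 2)) (q s : FreeAlgebra K X) :
    ⁅q, s⁆ * v ∈ tIdeal (FreeAlgebra K X) (k + 3) := by
  have : commSpan K (FreeAlgebra K X) (k + 2) ≤
      (tSubmodule K (FreeAlgebra K X) (k + 3)).comap (LinearMap.mulLeft K ⁅q, s⁆) := by
    refine commSpan_le_of_lie fun l hl b => ?_
    have h : ∀ p q s, ⁅p * ⁅q, s⁆, l⁆ ∈ tIdeal (FreeAlgebra K X) (k + 3) := fun p q s =>
      mem_tIdeal_of_mem_commSpan (lie_mul_lie_commSpan hX k hl p q s)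
    rw [Submodule.mem_comap, mem_tSubmodule, LinearMap.mulLeft_apply]
    -- With `c = ⁅q, s⁆`: `c * ⁅l, b⁆ = ⁅c, l⁆ * b - ⁅b * c, l⁆ - ⁅⁅c, b⁆, l⁆`.
    convert sub_mem (sub_mem ((tIdeal _ _).mul_mem_right _ b (h 1 q s)) (h b q s))
      (h 1 ⁅q, s⁆ b) using 1
    simp only [Ring.lie_def]; noncomm_ring
  exact this hv

theorem lie_mul_mem_tIdeal (hX : CardLeThree X) {k : ℕ} {y : FreeAlgebra K X}
    (hy : y ∈ tIdeal (FreeAlgebra K X) (k + 2)) (q s : FreeAlgebra K X) :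
    ⁅q, s⁆ * y ∈ tIdeal (FreeAlgebra K X) (k + 3) := by
  induction hy using TwoSidedIdeal.span_induction generalizing q s with
  | mem y hy => exact lie_mul_mem_of_mem_commSpan hX (Submodule.subset_span hy) q s
  | zero => rw [mul_zero]; exact zero_mem _
  | add x y _ _ hx hy => rw [mul_add]; exact add_mem (hx q s) (hy q s)
  | neg x _ hx => rw [mul_neg]; exact neg_mem (hx q s)
  | left_absorb b y _ hy =>
    convert add_mem ((tIdeal _ _).mul_mem_left b _ (hy q s)) (hy ⁅q, s⁆ b) using 1
    simp only [Ring.lie_def]; noncomm_ring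
  | right_absorb b y _ hy => rw [← mul_assoc]; exact (tIdeal _ _).mul_mem_right _ b (hy q s)

theorem lie_mem_tIdeal (hX : CardLeThree X) {k : ℕ} {y : FreeAlgebra K X}
    (hy : y ∈ tIdeal (FreeAlgebra K X) (k + 1)) (a : FreeAlgebra K X) :
    ⁅y, a⁆ ∈ tIdeal (FreeAlgebra K X) (k + 2) := by
  cases k with
  | zero => exact lie_mem_tIdeal_two y a
  | succ k =>
    induction hy using TwoSidedIdeal.span_induction generalizing a with
    | mem y hy =>
      exact mem_tIdeal_of_mem_commSpan (K := K) (lie_mem_commSpan (Submodule.subset_span hy) a)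
    | zero => rw [← lieRight_apply K, map_zero]; exact zero_mem _
    | add x y _ _ hx hy => rw [← lieRight_apply K, map_add]; exact add_mem (hx a) (hy a)
    | neg x _ hx => rw [← lieRight_apply K, map_neg]; exact neg_mem (hx a)
    | left_absorb b y h hy =>
      convert add_mem ((tIdeal _ _).mul_mem_left b _ (hy a)) (lie_mul_mem_tIdeal hX h b a) using 1
      simp only [Ring.lie_def]; noncomm_ring
    | right_absorb b y h hy =>
      convert add_mem (add_mem ((tIdeal _ _).mul_mem_right _ b (hy a))
        (lie_mul_mem_tIdeal hX h b a)) (hy ⁅b, a⁆) using 1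
      simp only [Ring.lie_def]; noncomm_ring

/-- Induction through `⁅u, c⁆ * y = ⁅u * y, c⁆ - u * ⁅y, c⁆`, where bracketing gains one step in
either term. -/
theorem commSpan_mul_mem_tIdeal (hX : CardLeThree X) :
    ∀ (a : ℕ) {b : ℕ} {u y : FreeAlgebra K X}, u ∈ commSpan K (FreeAlgebra K X) (a + 1) →
      y ∈ tIdeal (FreeAlgebra K X) (b + 1) → u * y ∈ tIdeal (FreeAlgebra K X) (a + b + 1)
  | 0, b, u, y, _, hy => by rw [zero_add]; exact (tIdeal _ _).mul_mem_left _ _ hy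
  | a + 1, b, u, y, hu, hy => by
    have : commSpan K (FreeAlgebra K X) (a + 2) ≤
        (tSubmodule K (FreeAlgebra K X) (a + b + 2)).comap (LinearMap.mulRight K y) := by
      refine commSpan_le_of_lie fun u hu c => ?_
      rw [Submodule.mem_comap, mem_tSubmodule, LinearMap.mulRight_apply]
      convert sub_mem (lie_mem_tIdeal hX (commSpan_mul_mem_tIdeal hX a hu hy) c)
        (commSpan_mul_mem_tIdeal hX a (b := b + 1) hu (lie_mem_tIdeal hX hy c)) using 1
      simp only [Ring.lie_def]; noncomm_ring
    have h := this hu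
    rwa [Submodule.mem_comap, mem_tSubmodule, show a + b + 2 = a + 1 + b + 1 by ring] at h

end RankThreeIdeals

/-! ### Centralizers of two generators in a free algebra -/

section Center

open FreeAlgebra

variable {K : Type*} [Field K] {X : Type*}

/-- An element of a free algebra commuting with two different generators is a scalar. -/
theorem exists_eq_algebraMap_of_commute {i j : X} (hij : i ≠ j) {f : FreeAlgebra K X}
    (hi : f * ι K i = ι K i * f) (hj : f * ι K j = ι K j * f) :
    ∃ c : K, f = algebraMap K _ c := by
  set e := equivMonoidAlgebraFreeMonoid (R := K) (X := X)
  -- Comparing coefficients at `w * xᵢ`: a word `w` occurring in `f` makes `w * xᵢ` begin with `xᵢ`.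
  -- For two distinct generators this leaves only the empty word.
  have key : ∀ i : X, f * ι K i = ι K i * f → ∀ w : FreeMonoid X, (e f).coeff w ≠ 0 →
      ∃ v, FreeMonoid.of i * v = w * FreeMonoid.of i := by
    intro i hi w hw
    have h := congrArg (fun g => (e g).coeff (w * FreeMonoid.of i)) hi
    have he : e (ι K i) = MonoidAlgebra.single (FreeMonoid.of i) 1 := by
      simp [e, equivMonoidAlgebraFreeMonoid]
    simp only [map_mul, he, MonoidAlgebra.coeff_mul_single_mul, mul_one] at h
    by_contra! hv
    rw [MonoidAlgebra.coeff_single_mul_of_forall_mul_ne _ _ hv] at h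
    exact hw h
  have hw : ∀ w : FreeMonoid X, (e f).coeff w ≠ 0 → w = 1 := by
    intro w hw
    obtain ⟨u, hu⟩ := key i hi w hw
    obtain ⟨v, hv⟩ := key j hj w hw
    have hu' := congrArg FreeMonoid.toList hu
    have hv' := congrArg FreeMonoid.toList hv
    simp only [FreeMonoid.toList_mul, FreeMonoid.toList_of] at hu' hv'
    rcases h : w.toList with _ | ⟨x, l⟩
    · exact FreeMonoid.toList.injective h
    · rw [h] at hu' hv'
      simp only [List.cons_append, List.nil_append, List.cons.injEq] at hu' hv'
      exact absurd (hu'.1.trans hv'.1.symm) hij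
  refine ⟨(e f).coeff 1, e.injective ?_⟩
  rw [AlgEquiv.commutes]
  ext w
  by_cases h : w = 1
  · subst h; simp
  · rw [not_imp_comm.1 (hw w) h]
    simp [h]

end Center

/-! ### The weight filtration by products of Lie monomials -/

section LieWords

open FreeAlgebra

variable (K : Type*) [Field K] {X : Type*}

/-- The Lie monomial in the free algebra given by a bracketing of generators. -/
def lieEval : FreeMagma X → FreeAlgebra K X
  | .of x => ι K x
  | .mul a b => ⁅lieEval a, lieEval b⁆

/-- The weight of a bracketing: the number of its brackets. -/
def lieWt : FreeMagma X → ℕ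
  | .of _ => 0
  | .mul a b => lieWt a + lieWt b + 1

/-- The product of a list of Lie monomials. -/
def wordEval (l : List (FreeMagma X)) : FreeAlgebra K X := (l.map (lieEval K)).prod

/-- The total weight of a list of Lie monomials. -/
def wordWt (l : List (FreeMagma X)) : ℕ := (l.map lieWt).sum

theorem wordEval_nil : wordEval K ([] : List (FreeMagma X)) = 1 := rfl

theorem wordEval_cons (c : FreeMagma X) (l : List (FreeMagma X)) :
    wordEval K (c :: l) = lieEval K c * wordEval K l := by simp [wordEval]

theorem wordEval_append (l l' : List (FreeMagma X)) :
    wordEval K (l ++ l') = wordEval K l * wordEval K l' := by simp [wordEval]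

theorem wordWt_cons (c : FreeMagma X) (l : List (FreeMagma X)) :
    wordWt (c :: l) = lieWt c + wordWt l := by simp [wordWt]

theorem wordWt_append (l l' : List (FreeMagma X)) :
    wordWt (l ++ l') = wordWt l + wordWt l' := by simp [wordWt]

variable (X) in
/-- The span of the products of `s` Lie monomials of total weight `w`. -/
def wordSpan (s w : ℕ) : Submodule K (FreeAlgebra K X) :=
  Submodule.span K (wordEval K '' {l : List (FreeMagma X) | l.length = s ∧ wordWt l = w})

variable (X) in
/-- The span of the products of Lie monomials of total weight at least `w`. -/
def wtFiltration (w : ℕ) : Submodule K (FreeAlgebra K X) :=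
  Submodule.span K (wordEval K '' {l : List (FreeMagma X) | w ≤ wordWt l})

variable {K}

theorem wordEval_mem_wordSpan {l : List (FreeMagma X)} {s w : ℕ} (hs : l.length = s)
    (hw : wordWt l = w) : wordEval K l ∈ wordSpan K X s w :=
  Submodule.subset_span ⟨l, ⟨hs, hw⟩, rfl⟩

theorem wordEval_mem_wtFiltration {l : List (FreeMagma X)} {w : ℕ} (hw : w ≤ wordWt l) :
    wordEval K l ∈ wtFiltration K X w :=
  Submodule.subset_span ⟨l, hw, rfl⟩

theorem wtFiltration_antitone {v w : ℕ} (h : v ≤ w) : wtFiltration K X w ≤ wtFiltration K X v :=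
  Submodule.span_mono (Set.image_mono fun _ hl => h.trans hl)

theorem wordSpan_le_wtFiltration (s w : ℕ) : wordSpan K X s w ≤ wtFiltration K X w :=
  Submodule.span_mono (Set.image_mono fun _ hl => hl.2.ge)

theorem mem_wtFiltration_zero (p : FreeAlgebra K X) : p ∈ wtFiltration K X 0 := by
  refine Submodule.span_mono ?_ (mem_span_words p)
  rintro _ ⟨w, rfl⟩
  exact ⟨w.map FreeMagma.of, Nat.zero_le _, by simp [wordEval, Function.comp_def, lieEval]⟩

theorem mul_mem_wordSpan {s s' w w' : ℕ} {x y : FreeAlgebra K X} (hx : x ∈ wordSpan K X s w)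
    (hy : y ∈ wordSpan K X s' w') : x * y ∈ wordSpan K X (s + s') (w + w') := by
  have h : wordSpan K X s w * wordSpan K X s' w' ≤ wordSpan K X (s + s') (w + w') := by
    rw [wordSpan, wordSpan, Submodule.span_mul_span, Submodule.span_le]
    rintro _ ⟨_, ⟨l, hl, rfl⟩, _, ⟨l', hl', rfl⟩, rfl⟩
    dsimp only
    rw [← wordEval_append]
    exact wordEval_mem_wordSpan (by rw [List.length_append, hl.1, hl'.1])
      (by rw [wordWt_append, hl.2, hl'.2])
  exact h (Submodule.mul_mem_mul hx hy)

theorem mul_mem_wtFiltration {w w' : ℕ} {x y : FreeAlgebra K X} (hx : x ∈ wtFiltration K X w)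
    (hy : y ∈ wtFiltration K X w') : x * y ∈ wtFiltration K X (w + w') := by
  have h : wtFiltration K X w * wtFiltration K X w' ≤ wtFiltration K X (w + w') := by
    rw [wtFiltration, wtFiltration, Submodule.span_mul_span, Submodule.span_le]
    rintro _ ⟨_, ⟨l, hl, rfl⟩, _, ⟨l', hl', rfl⟩, rfl⟩
    dsimp only
    rw [← wordEval_append]
    exact wordEval_mem_wtFiltration (by rw [wordWt_append]; exact add_le_add hl hl')
  exact h (Submodule.mul_mem_mul hx hy)

theorem lieEval_mem_wordSpan (c : FreeMagma X) : lieEval K c ∈ wordSpan K X 1 (lieWt c) := by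
  have : wordEval K [c] ∈ wordSpan K X 1 (lieWt c) :=
    wordEval_mem_wordSpan rfl (by simp [wordWt])
  simpa [wordEval] using this

/-- Bracketing with `c` is a derivation: it replaces one factor `d` by `⁅d, c⁆`, keeping the number
of factors. -/
theorem lie_lieEval_mem_wordSpan (c : FreeMagma X) (l : List (FreeMagma X)) :
    ⁅wordEval K l, lieEval K c⁆ ∈ wordSpan K X l.length (wordWt l + lieWt c + 1) := by
  induction l with
  | nil => rw [wordEval_nil, Ring.lie_def, one_mul, mul_one, sub_self]; exact zero_mem _
  | cons d l ih =>
    have h₁ := mul_mem_wordSpan (lieEval_mem_wordSpan d) ih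
    have h₂ := mul_mem_wordSpan (lieEval_mem_wordSpan (K := K) (d * c))
      (wordEval_mem_wordSpan (K := K) (l := l) rfl rfl)
    rw [List.length_cons, wordWt_cons, add_comm l.length]
    rw [show lieWt d + (wordWt l + lieWt c + 1) = lieWt d + wordWt l + lieWt c + 1 by ring] at h₁
    rw [show lieWt (d * c) = lieWt d + lieWt c + 1 from rfl,
      show lieWt d + lieWt c + 1 + wordWt l = lieWt d + wordWt l + lieWt c + 1 by ring] at h₂
    convert add_mem h₁ h₂ using 1
    rw [wordEval_cons, show lieEval K (d * c) = ⁅lieEval K d, lieEval K c⁆ from rfl]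
    simp only [Ring.lie_def]; noncomm_ring

theorem lie_wordEval_mem_wtFiltration (l l' : List (FreeMagma X)) :
    ⁅wordEval K l, wordEval K l'⁆ ∈ wtFiltration K X (wordWt l + wordWt l' + 1) := by
  induction l' with
  | nil => rw [wordEval_nil, Ring.lie_def, one_mul, mul_one, sub_self]; exact zero_mem _
  | cons d l' ih =>
    have h₁ := mul_mem_wtFiltration
      (wordSpan_le_wtFiltration _ _ (lie_lieEval_mem_wordSpan (K := K) d l))
      (wordEval_mem_wtFiltration (K := K) (l := l') le_rfl)
    have h₂ := mul_mem_wtFiltration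
      (wordSpan_le_wtFiltration _ _ (lieEval_mem_wordSpan (K := K) d)) ih
    rw [wordWt_cons]
    rw [show wordWt l + lieWt d + 1 + wordWt l' = wordWt l + (lieWt d + wordWt l') + 1 by ring]
      at h₁
    rw [show lieWt d + (wordWt l + wordWt l' + 1) = wordWt l + (lieWt d + wordWt l') + 1 by ring]
      at h₂
    convert add_mem h₁ h₂ using 1
    rw [wordEval_cons]
    simp only [Ring.lie_def]; noncomm_ring

theorem lie_mem_wtFiltration {w w' : ℕ} {x y : FreeAlgebra K X} (hx : x ∈ wtFiltration K X w)
    (hy : y ∈ wtFiltration K X w') : ⁅x, y⁆ ∈ wtFiltration K X (w + w' + 1) := by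
  have h₁ : ∀ l, w ≤ wordWt l → wtFiltration K X w' ≤
      (wtFiltration K X (w + w' + 1)).comap (lieLeft K (wordEval K l)) := by
    refine fun l hl => Submodule.span_le.2 ?_
    rintro _ ⟨l', hl', rfl⟩
    exact wtFiltration_antitone (by change w' ≤ wordWt l' at hl'; omega)
      (lie_wordEval_mem_wtFiltration l l')
  have h₂ : wtFiltration K X w ≤ (wtFiltration K X (w + w' + 1)).comap (lieRight K y) := by
    refine Submodule.span_le.2 ?_
    rintro _ ⟨l, hl, rfl⟩
    exact h₁ l hl hy
  exact h₂ hx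

theorem longComm_mem_wtFiltration (a : ℕ → FreeAlgebra K X) (k : ℕ) :
    longComm a (k + 1) ∈ wtFiltration K X k := by
  induction k with
  | zero => exact mem_wtFiltration_zero _
  | succ k ih =>
    rw [longComm]
    have h := lie_mem_wtFiltration ih (mem_wtFiltration_zero (a (k + 1)))
    rwa [add_zero] at h

theorem tIdeal_le_wtFiltration {k : ℕ} {x : FreeAlgebra K X}
    (hx : x ∈ tIdeal (FreeAlgebra K X) (k + 1)) : x ∈ wtFiltration K X k := by
  induction hx using TwoSidedIdeal.span_induction with
  | mem x hx =>
    obtain ⟨a, rfl⟩ := hx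
    exact longComm_mem_wtFiltration a k
  | zero => exact zero_mem _
  | add x y _ _ hx hy => exact add_mem hx hy
  | neg x _ hx => exact neg_mem hx
  | left_absorb a x _ hx => simpa using mul_mem_wtFiltration (mem_wtFiltration_zero a) hx
  | right_absorb a x _ hx => simpa using mul_mem_wtFiltration hx (mem_wtFiltration_zero a)

theorem lieEval_mem_commSpan :
    ∀ c : FreeMagma X, lieEval K c ∈ commSpan K (FreeAlgebra K X) (lieWt c + 1)
  | .of x => by rw [lieWt, commSpan_one]; trivial
  | .mul a b => lie_commSpan_mem (lieWt b) (lieEval_mem_commSpan a) (lieEval_mem_commSpan b)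

variable [CharZero K]

theorem wordEval_mem_tIdeal (hX : CardLeThree X) (l : List (FreeMagma X)) :
    wordEval K l ∈ tIdeal (FreeAlgebra K X) (wordWt l + 1) := by
  induction l with
  | nil => exact mem_tIdeal_one _
  | cons c l ih =>
    rw [wordEval_cons, wordWt_cons]
    exact commSpan_mul_mem_tIdeal hX (lieWt c) (lieEval_mem_commSpan c) ih

theorem tIdeal_antitone {A : Type*} [Ring A] {m n : ℕ} (hm : 1 ≤ m) (h : m ≤ n) :
    tIdeal A n ≤ tIdeal A m := by
  induction n, h using Nat.le_induction with
  | base => exact le_rfl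
  | succ n hn ih =>
    obtain ⟨k, rfl⟩ : ∃ k, n = k + 1 := ⟨n - 1, by omega⟩
    exact (tIdeal_succ_le k).trans ih

/-- In rank at most three, `T⁽ᵏ⁺¹⁾` is the span of the products of Lie monomials of total weight at
least `k`. -/
theorem mem_tIdeal_iff_mem_wtFiltration (hX : CardLeThree X) {k : ℕ} {x : FreeAlgebra K X} :
    x ∈ tIdeal (FreeAlgebra K X) (k + 1) ↔ x ∈ wtFiltration K X k := by
  refine ⟨tIdeal_le_wtFiltration, fun hx => ?_⟩
  have : wtFiltration K X k ≤ tSubmodule K (FreeAlgebra K X) (k + 1) := by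
    refine Submodule.span_le.2 ?_
    rintro _ ⟨l, hl, rfl⟩
    exact tIdeal_antitone (by omega) (Nat.succ_le_succ hl) (wordEval_mem_tIdeal hX l)
  exact this hx

end LieWords

/-! ### The Adams operator and its eigenspaces -/

section Adams

open FreeAlgebra TensorProduct

variable (K : Type*) [Field K] (X : Type*)

/-- The algebra homomorphism `F → F ⊗ F` sending each generator `x` to `(x ⊗ 1 + 1 ⊗ x) / 2`. -/
noncomputable def halfCoproduct : FreeAlgebra K X →ₐ[K] FreeAlgebra K X ⊗[K] FreeAlgebra K X :=
  FreeAlgebra.lift K fun i => (2⁻¹ : K) • (ι K i ⊗ₜ[K] 1 + 1 ⊗ₜ[K] ι K i)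

/-- The rescaled Adams operator: `halfCoproduct` followed by multiplication. -/
noncomputable def adams : FreeAlgebra K X →ₗ[K] FreeAlgebra K X :=
  LinearMap.mul' K (FreeAlgebra K X) ∘ₗ (halfCoproduct K X).toLinearMap

variable {K X}

theorem adams_apply (f : FreeAlgebra K X) :
    adams K X f = LinearMap.mul' K (FreeAlgebra K X) (halfCoproduct K X f) := rfl

theorem halfCoproduct_ι (i : X) :
    halfCoproduct K X (ι K i) = (2⁻¹ : K) • (ι K i ⊗ₜ[K] 1 + 1 ⊗ₜ[K] ι K i) :=
  lift_ι_apply _ _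

/-- Bracketing with a primitive tensor is the Leibniz action on the two factors, which
multiplication respects. -/
theorem mul'_lie (z : FreeAlgebra K X ⊗[K] FreeAlgebra K X) (a : FreeAlgebra K X) :
    LinearMap.mul' K (FreeAlgebra K X) ⁅z, a ⊗ₜ[K] 1 + 1 ⊗ₜ[K] a⁆ =
      ⁅LinearMap.mul' K (FreeAlgebra K X) z, a⁆ := by
  induction z with
  | zero => simp [Ring.lie_def]
  | add x y hx hy =>
    rw [← lieRight_apply K, ← lieRight_apply K] at *
    rw [map_add, map_add, hx, hy, map_add, map_add]
  | tmul x y =>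
    simp only [Ring.lie_def, mul_add, add_mul, Algebra.TensorProduct.tmul_mul_tmul, map_sub,
      map_add, LinearMap.mul'_apply, mul_one, one_mul]
    noncomm_ring

theorem adams_lie_ι (f : FreeAlgebra K X) (i : X) :
    adams K X ⁅f, ι K i⁆ = (2⁻¹ : K) • ⁅adams K X f, ι K i⁆ := by
  rw [adams_apply, adams_apply, ← mul'_lie, ← map_smul]
  congr 1
  simp only [Ring.lie_def, map_sub, map_mul, halfCoproduct_ι, mul_smul_comm, smul_mul_assoc,
    smul_sub]

/-- Lie elements are primitive; the exponent is the degree of `c`, one factor `1/2` for each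
generator. -/
theorem halfCoproduct_lieEval : ∀ c : FreeMagma X,
    halfCoproduct K X (lieEval K c) =
      (2⁻¹ : K) ^ (lieWt c + 1) • (lieEval K c ⊗ₜ[K] 1 + 1 ⊗ₜ[K] lieEval K c)
  | .of x => by rw [lieWt, lieEval, halfCoproduct_ι, zero_add, pow_one]
  | .mul a b => by
    rw [lieEval, lieWt, Ring.lie_def, map_sub, map_mul, map_mul, halfCoproduct_lieEval a,
      halfCoproduct_lieEval b]
    simp only [mul_smul_comm, smul_mul_assoc, smul_smul, ← pow_add]
    rw [show lieWt b + 1 + (lieWt a + 1) = lieWt a + lieWt b + 1 + 1 by ring,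
      show lieWt a + 1 + (lieWt b + 1) = lieWt a + lieWt b + 1 + 1 by ring]
    refine (smul_sub _ _ _).symm.trans ?_
    congr 1
    simp only [mul_add, add_mul, Algebra.TensorProduct.tmul_mul_tmul, mul_one, one_mul,
      TensorProduct.sub_tmul, TensorProduct.tmul_sub]
    abel

variable (K X) in
/-- The span of the tensors of two products of Lie monomials with `s` factors and weight `w`
in total. -/
def wordTensorSpan (s w : ℕ) : Submodule K (FreeAlgebra K X ⊗[K] FreeAlgebra K X) :=
  Submodule.span K {z | ∃ l l' : List (FreeMagma X), l.length + l'.length = s ∧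
    wordWt l + wordWt l' = w ∧ z = wordEval K l ⊗ₜ[K] wordEval K l'}

theorem halfCoproduct_wordEval (l : List (FreeMagma X)) :
    halfCoproduct K X (wordEval K l) ∈ wordTensorSpan K X l.length (wordWt l) := by
  induction l with
  | nil =>
    rw [wordEval_nil, map_one]
    exact Submodule.subset_span ⟨[], [], rfl, rfl, rfl⟩
  | cons c l ih =>
    rw [wordEval_cons, map_mul, halfCoproduct_lieEval, smul_mul_assoc]
    refine Submodule.smul_mem _ _ ?_
    have : wordTensorSpan K X l.length (wordWt l) ≤
        (wordTensorSpan K X (c :: l).length (wordWt (c :: l))).comap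
          (LinearMap.mulLeft K (lieEval K c ⊗ₜ[K] 1 + 1 ⊗ₜ[K] lieEval K c)) := by
      refine Submodule.span_le.2 ?_
      rintro _ ⟨l₁, l₂, hs, hw, rfl⟩
      rw [SetLike.mem_coe, Submodule.mem_comap, LinearMap.mulLeft_apply, add_mul,
        Algebra.TensorProduct.tmul_mul_tmul, Algebra.TensorProduct.tmul_mul_tmul, one_mul, one_mul]
      refine add_mem (Submodule.subset_span ⟨c :: l₁, l₂, ?_, ?_, ?_⟩)
        (Submodule.subset_span ⟨l₁, c :: l₂, ?_, ?_, ?_⟩)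
      all_goals simp only [List.length_cons, wordWt_cons, wordEval_cons]
      all_goals omega
    exact this ih

variable (K X) in
/-- The span of the products of less than `s` Lie monomials having the same total degree as a
product of `s` Lie monomials of weight `w`. -/
def lowerWordSpan (s w : ℕ) : Submodule K (FreeAlgebra K X) :=
  Submodule.span K (wordEval K '' {l : List (FreeMagma X) | l.length < s ∧
    l.length + wordWt l = s + w})

theorem wordSpan_le_lowerWordSpan (s w : ℕ) :
    wordSpan K X s (w + 1) ≤ lowerWordSpan K X (s + 1) w :=
  Submodule.span_mono (Set.image_mono fun l ⟨hs, hw⟩ => ⟨by omega, by omega⟩)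

theorem mul'_mulLeft_mem {s w : ℕ} (c : FreeMagma X) {z : FreeAlgebra K X ⊗[K] FreeAlgebra K X}
    (hz : z ∈ wordTensorSpan K X s w) :
    LinearMap.mul' K _ ((lieEval K c ⊗ₜ[K] 1 + 1 ⊗ₜ[K] lieEval K c) * z) -
      (lieEval K c * LinearMap.mul' K _ z + lieEval K c * LinearMap.mul' K _ z) ∈
        wordSpan K X s (w + lieWt c + 1) := by
  have : wordTensorSpan K X s w ≤ (wordSpan K X s (w + lieWt c + 1)).comap
      (LinearMap.mul' K _ ∘ₗ LinearMap.mulLeft K (lieEval K c ⊗ₜ[K] 1 + 1 ⊗ₜ[K] lieEval K c) -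
        (LinearMap.mulLeft K (lieEval K c) ∘ₗ LinearMap.mul' K _ +
          LinearMap.mulLeft K (lieEval K c) ∘ₗ LinearMap.mul' K _)) := by
    refine Submodule.span_le.2 ?_
    rintro _ ⟨l₁, l₂, hs, hw, rfl⟩
    -- The term `1 ⊗ c` yields `l₁ * c * l₂` instead of `c * l₁ * l₂`; the error is `⁅l₁, c⁆ * l₂`.
    have h := mul_mem_wordSpan (lie_lieEval_mem_wordSpan (K := K) c l₁)
      (wordEval_mem_wordSpan (K := K) (l := l₂) rfl rfl)
    rw [hs, show wordWt l₁ + lieWt c + 1 + wordWt l₂ = w + lieWt c + 1 by omega] at h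
    rw [SetLike.mem_coe, Submodule.mem_comap]
    convert h using 1
    simp only [LinearMap.sub_apply, LinearMap.add_apply, LinearMap.comp_apply,
      LinearMap.mulLeft_apply, add_mul, Algebra.TensorProduct.tmul_mul_tmul, one_mul, map_add,
      LinearMap.mul'_apply, Ring.lie_def]
    noncomm_ring
  exact this hz

variable (K X) in
/-- The elements of the weight filtration on which the Adams operator acts as on products of
weight exactly `w`. -/
noncomputable def wtSpace (w : ℕ) : Submodule K (FreeAlgebra K X) :=
  Module.End.eigenspace (adams K X) ((2⁻¹ : K) ^ w) ⊓ wtFiltration K X w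

theorem mem_wtSpace {w : ℕ} {f : FreeAlgebra K X} : f ∈ wtSpace K X w ↔
    adams K X f = (2⁻¹ : K) ^ w • f ∧ f ∈ wtFiltration K X w := by
  rw [wtSpace, Submodule.mem_inf, Module.End.mem_eigenspace_iff]

variable [CharZero K]

/-- The coproduct of `s` primitive factors has `2ˢ` terms, each multiplying to the same product up
to reordering. The scaling is `2⁻¹` to the degree `s + w`, leaving `2⁻ʷ`; reordering loses factors
but not degree. -/
theorem adams_wordEval_sub_mem (l : List (FreeMagma X)) :
    adams K X (wordEval K l) - (2⁻¹ : K) ^ wordWt l • wordEval K l ∈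
      lowerWordSpan K X l.length (wordWt l) := by
  induction l with
  | nil =>
    rw [wordEval_nil, adams_apply, map_one, Algebra.TensorProduct.one_def, LinearMap.mul'_apply]
    simp [wordWt]
  | cons c l ih =>
    have h₁ : lieEval K c * (adams K X (wordEval K l) - (2⁻¹ : K) ^ wordWt l • wordEval K l) ∈
        lowerWordSpan K X (c :: l).length (wordWt (c :: l)) := by
      have : lowerWordSpan K X l.length (wordWt l) ≤
          (lowerWordSpan K X (c :: l).length (wordWt (c :: l))).comap
            (LinearMap.mulLeft K (lieEval K c)) := by
        refine Submodule.span_le.2 ?_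
        rintro _ ⟨l', ⟨hs, hw⟩, rfl⟩
        rw [SetLike.mem_coe, Submodule.mem_comap, LinearMap.mulLeft_apply, ← wordEval_cons]
        refine Submodule.subset_span ⟨_, ⟨?_, ?_⟩, rfl⟩ <;>
        simp only [List.length_cons, wordWt_cons] <;> omega
      exact this ih
    have h₂ := wordSpan_le_lowerWordSpan _ _
      (mul'_mulLeft_mem c (halfCoproduct_wordEval (K := K) l))
    rw [add_comm (wordWt l), ← wordWt_cons, ← List.length_cons (a := c)] at h₂
    convert add_mem (Submodule.smul_mem _ ((2⁻¹ : K) ^ lieWt c) h₁)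
      (Submodule.smul_mem _ ((2⁻¹ : K) ^ (lieWt c + 1)) h₂) using 1
    rw [adams_apply, adams_apply, wordEval_cons, map_mul, halfCoproduct_lieEval, smul_mul_assoc,
      map_smul, wordWt_cons, smul_sub, ← two_smul K (_ * _), smul_smul, pow_succ, mul_assoc,
      inv_mul_cancel₀ (two_ne_zero), mul_one, mul_sub, smul_sub, mul_smul_comm, smul_smul,
      ← pow_add]
    abel

theorem inv_two_pow_injective : Function.Injective fun w : ℕ => (2⁻¹ : K) ^ w := by
  intro a b h
  simp only [inv_pow, inv_inj] at h
  exact Nat.pow_right_injective le_rfl (by exact_mod_cast h)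

theorem wordEval_mem_iSup_wtSpace (l : List (FreeMagma X)) :
    wordEval K l ∈ ⨆ i, ⨆ _ : wordWt l ≤ i, wtSpace K X i := by
  induction h : l.length using Nat.strong_induction_on generalizing l with
  | _ s ih =>
  subst h
  have h₁ : lowerWordSpan K X l.length (wordWt l) ≤
      ⨆ i, ⨆ _ : wordWt l + 1 ≤ i, wtSpace K X i := by
    refine Submodule.span_le.2 ?_
    rintro _ ⟨l', ⟨hs, hw⟩, rfl⟩
    have := ih _ hs l' rfl
    have hle : (⨆ i, ⨆ _ : wordWt l' ≤ i, wtSpace K X i) ≤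
        ⨆ i, ⨆ _ : wordWt l + 1 ≤ i, wtSpace K X i := biSup_mono fun i hi => by omega
    exact hle this
  -- On strictly higher weights `adams - 2⁻ʷ` is invertible, so the error term can be removed by
  -- subtracting some `v` of higher weight.
  have h₂ : (⨆ i, ⨆ _ : wordWt l + 1 ≤ i, wtSpace K X i) ≤
      ((⨆ i, ⨆ _ : wordWt l + 1 ≤ i, wtSpace K X i) ⊓ wtFiltration K X (wordWt l)).map
        (adams K X - (2⁻¹ : K) ^ wordWt l • LinearMap.id) := by
    refine iSup₂_le fun i hi f hf => ?_
    obtain ⟨h₁, h₂⟩ := mem_wtSpace.1 hf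
    have hne : (2⁻¹ : K) ^ i - (2⁻¹ : K) ^ wordWt l ≠ 0 := by
      rw [sub_ne_zero]
      intro h
      have := inv_two_pow_injective h
      omega
    refine ⟨((2⁻¹ : K) ^ i - (2⁻¹ : K) ^ wordWt l)⁻¹ • f, Submodule.smul_mem _ _ ⟨?_, ?_⟩, ?_⟩
    · exact (le_iSup₂ (f := fun i (_ : wordWt l + 1 ≤ i) => wtSpace K X i) i hi) hf
    · exact wtFiltration_antitone (by omega) h₂
    · rw [map_smul, LinearMap.sub_apply, h₁, LinearMap.smul_apply, LinearMap.id_apply, ← sub_smul,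
        smul_smul, inv_mul_cancel₀ hne, one_smul]
  obtain ⟨v, ⟨hv₁, hv₂⟩, hv⟩ := h₂ (h₁ (adams_wordEval_sub_mem l))
  have h₃ : wordEval K l - v ∈ wtSpace K X (wordWt l) := by
    refine mem_wtSpace.2 ⟨?_, sub_mem (wordEval_mem_wtFiltration le_rfl) hv₂⟩
    rw [LinearMap.sub_apply, LinearMap.smul_apply, LinearMap.id_apply] at hv
    rw [map_sub, smul_sub, ← sub_eq_zero, ← sub_eq_zero.2 hv.symm]
    abel
  rw [← sub_add_cancel (wordEval K l) v]
  refine add_mem ((le_iSup₂ (f := fun i (_ : wordWt l ≤ i) => wtSpace K X i) _ le_rfl) h₃) ?_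
  have hle : (⨆ i, ⨆ _ : wordWt l + 1 ≤ i, wtSpace K X i) ≤
      ⨆ i, ⨆ _ : wordWt l ≤ i, wtSpace K X i := biSup_mono fun i hi => by omega
  exact hle hv₁

theorem wtFiltration_le_iSup_wtSpace (w : ℕ) :
    wtFiltration K X w ≤ ⨆ i, ⨆ _ : w ≤ i, wtSpace K X i := by
  refine Submodule.span_le.2 ?_
  rintro _ ⟨l, hl, rfl⟩
  have hle : (⨆ i, ⨆ _ : wordWt l ≤ i, wtSpace K X i) ≤ ⨆ i, ⨆ _ : w ≤ i, wtSpace K X i :=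
    biSup_mono fun i hi => le_trans hl hi
  exact hle (wordEval_mem_iSup_wtSpace l)

/-- An element whose brackets with the generators all have weight at least `m + 1` has itself weight
at least `m`, up to a scalar. -/
theorem exists_sub_algebraMap_mem_wtFiltration {i j : X} (hij : i ≠ j) {m : ℕ}
    {f : FreeAlgebra K X} (hf : ∀ k, ⁅f, ι K k⁆ ∈ wtFiltration K X (m + 1)) :
    ∃ c : K, f - algebraMap K _ c ∈ wtFiltration K X m := by
  have hf₀ : f ∈ ⨆ i, wtSpace K X i := by
    have := wtFiltration_le_iSup_wtSpace (K := K) (X := X) 0 (mem_wtFiltration_zero f)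
    simpa using this
  rw [iSup_split (wtSpace K X) fun i => i < m, Submodule.mem_sup] at hf₀
  obtain ⟨g, hg, h, hh, rfl⟩ := hf₀
  have hhm : h ∈ wtFiltration K X m := by
    refine (iSup₂_le fun i hi => ?_ : (⨆ i, ⨆ _ : ¬ i < m, wtSpace K X i) ≤ _) hh
    exact inf_le_right.trans (wtFiltration_antitone (not_lt.1 hi))
  -- The bracket of the low part lies in eigenspaces of weight at most `m`, yet also in those of
  -- weight at least `m + 1`; these are independent.
  have hgk : ∀ k : X, ⁅g, ι K k⁆ = 0 := by
    intro k
    have h₁ : ⁅g, ι K k⁆ ∈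
        ⨆ i, ⨆ _ : i < m + 1, Module.End.eigenspace (adams K X) ((2⁻¹ : K) ^ i) := by
      refine (iSup₂_le fun i hi g hg => ?_ : (⨆ i, ⨆ _ : i < m, wtSpace K X i) ≤
        (⨆ i, ⨆ _ : i < m + 1, Module.End.eigenspace (adams K X) ((2⁻¹ : K) ^ i)).comap
          (lieRight K (ι K k))) hg
      refine (le_iSup₂ (f := fun i (_ : i < m + 1) =>
        Module.End.eigenspace (adams K X) ((2⁻¹ : K) ^ i))
        (i + 1) (by omega)) ?_
      rw [lieRight_apply, Module.End.mem_eigenspace_iff, adams_lie_ι, (mem_wtSpace.1 hg).1,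
        ← lieRight_apply K, map_smul, smul_smul, lieRight_apply, pow_succ']
    have h₂ : ⁅g, ι K k⁆ ∈ ⨆ i, ⨆ _ : m + 1 ≤ i, Module.End.eigenspace (adams K X) ((2⁻¹ : K) ^ i) := by
      have h₃ : ⁅g, ι K k⁆ ∈ wtFiltration K X (m + 1) := by
        have h₄ := lie_mem_wtFiltration hhm (mem_wtFiltration_zero (ι K k))
        convert sub_mem (hf k) h₄ using 1
        simp only [Ring.lie_def]; noncomm_ring
      have hle : (⨆ i, ⨆ _ : m + 1 ≤ i, wtSpace K X i) ≤
          ⨆ i, ⨆ _ : m + 1 ≤ i, Module.End.eigenspace (adams K X) ((2⁻¹ : K) ^ i) :=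
        iSup₂_mono fun i _ => inf_le_left
      exact hle (wtFiltration_le_iSup_wtSpace _ h₃)
    have hind := (Module.End.eigenspaces_iSupIndep (adams K X)).comp (inv_two_pow_injective (K := K))
    have hdisj := hind.disjoint_biSup_biSup (s := {i | i < m + 1}) (t := {i | m + 1 ≤ i})
      (by rw [Set.disjoint_left]; exact fun i hi hi' => absurd (show i < m + 1 from hi) (not_lt.2 hi'))
    exact Submodule.disjoint_def.1 hdisj _ h₁ h₂
  obtain ⟨c, rfl⟩ := exists_eq_algebraMap_of_commute hij (sub_eq_zero.1 (hgk i))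
    (sub_eq_zero.1 (hgk j))
  exact ⟨c, by simpa using hhm⟩

end Adams

/-! ### Passage to the relatively free algebra -/

section Transfer

open FreeAlgebra

variable (K : Type*) [Field K]

theorem relFreeGen_mem (n : ℕ) {r : ℕ} (i : Fin r) : relFreeGen K n i ∈ relFreeRank K n r :=
  Algebra.subset_adjoin ⟨i, i.2, rfl⟩

/-- The canonical map from the free algebra of rank `r` to the relatively free algebra. -/
noncomputable def rankMap (n r : ℕ) : FreeAlgebra K (Fin r) →ₐ[K] relFreeRank K n r :=
  FreeAlgebra.lift K fun i => ⟨relFreeGen K n i, relFreeGen_mem K n i⟩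

variable {K} {n r : ℕ}

theorem rankMap_ι (i : Fin r) :
    rankMap K n r (ι K i) = ⟨relFreeGen K n i, relFreeGen_mem K n i⟩ :=
  lift_ι_apply _ _

theorem rankMap_surjective : Function.Surjective (rankMap K n r) := by
  rintro ⟨u, hu⟩
  suffices h : ∃ f, (rankMap K n r f : RelFree K n) = u from h.imp fun f hf => Subtype.ext hf
  induction hu using Algebra.adjoin_induction with
  | mem u hu =>
    obtain ⟨i, hi, rfl⟩ := hu
    exact ⟨ι K ⟨i, hi⟩, by rw [rankMap_ι]⟩
  | algebraMap c => exact ⟨algebraMap K _ c, by rw [AlgHom.commutes]; rfl⟩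
  | add u v _ _ hu hv =>
    obtain ⟨f, rfl⟩ := hu
    obtain ⟨g, rfl⟩ := hv
    exact ⟨f + g, by rw [map_add]; rfl⟩
  | mul u v _ _ hu hv =>
    obtain ⟨f, rfl⟩ := hu
    obtain ⟨g, rfl⟩ := hv
    exact ⟨f * g, by rw [map_mul]; rfl⟩

theorem coe_rankMap (f : FreeAlgebra K (Fin r)) :
    (rankMap K n r f : RelFree K n) =
      (tIdeal (FreeAlgebra K ℕ) n).ringCon.mk'
        (FreeAlgebra.lift K (fun i : Fin r => ι K (i : ℕ)) f) := by
  have : (relFreeRank K n r).val.comp (rankMap K n r) =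
      ((tIdeal (FreeAlgebra K ℕ) n).ringCon.mkₐ (α := K)).comp
        (FreeAlgebra.lift K fun i : Fin r => ι K (i : ℕ)) := by
    ext i
    simp only [Function.comp_apply, AlgHom.comp_apply, rankMap_ι, lift_ι_apply]
    rfl
  exact DFunLike.congr_fun this f

theorem rankMap_eq_zero_iff {f : FreeAlgebra K (Fin r)} :
    rankMap K n r f = 0 ↔ f ∈ tIdeal (FreeAlgebra K (Fin r)) n := by
  rw [← Subtype.coe_inj, coe_rankMap]
  set σ : FreeAlgebra K (Fin r) →ₐ[K] FreeAlgebra K ℕ :=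
    FreeAlgebra.lift K fun i : Fin r => ι K (i : ℕ)
  -- Killing the remaining generators gives a retraction, so membership in `T⁽ⁿ⁾` can be tested
  -- within rank `r`.
  let ρ : FreeAlgebra K ℕ →ₐ[K] FreeAlgebra K (Fin r) :=
    FreeAlgebra.lift K fun i : ℕ => if h : i < r then ι K ⟨i, h⟩ else 0
  have hρσ : ∀ f, ρ (σ f) = f := by
    have : ρ.comp σ = AlgHom.id K _ := by
      ext i
      simp [ρ, σ]
    exact DFunLike.congr_fun this
  have hmem : (tIdeal (FreeAlgebra K ℕ) n).ringCon.mk' (σ f) =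
      ((0 : relFreeRank K n r) : RelFree K n) ↔ σ f ∈ tIdeal (FreeAlgebra K ℕ) n := by
    rw [TwoSidedIdeal.mem_iff]
    exact (RingCon.eq _)
  rw [hmem]
  refine ⟨fun h => ?_, fun h => map_mem_tIdeal σ.toRingHom h⟩
  have := map_mem_tIdeal (ρ : FreeAlgebra K ℕ →+* FreeAlgebra K (Fin r)) h
  rwa [RingHom.coe_coe, hρσ] at this

theorem rankMap_mem_tIdeal_iff {m : ℕ} (hm : 1 ≤ m) (hmn : m ≤ n) {f : FreeAlgebra K (Fin r)} :
    rankMap K n r f ∈ tIdeal (relFreeRank K n r) m ↔ f ∈ tIdeal (FreeAlgebra K (Fin r)) m := by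
  refine ⟨fun h => ?_, fun h => map_mem_tIdeal (rankMap K n r).toRingHom h⟩
  obtain ⟨g, hg, hgf⟩ := exists_mem_tIdeal_of_surjective
    (φ := (rankMap K n r : FreeAlgebra K (Fin r) →+* relFreeRank K n r)) rankMap_surjective h
  have hfg : f - g ∈ tIdeal (FreeAlgebra K (Fin r)) n := by
    rw [← rankMap_eq_zero_iff, map_sub, sub_eq_zero]
    exact hgf.symm
  simpa using add_mem (tIdeal_antitone hm hmn hfg) hg

/-- The augmentation lands in a commutative ring, where commutators vanish. -/
theorem algebraMapInv_eq_zero_of_mem_tIdeal {X : Type*} {m : ℕ} {f : FreeAlgebra K X}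
    (hf : f ∈ tIdeal (FreeAlgebra K X) (m + 2)) : algebraMapInv f = (0 : K) := by
  have h := map_mem_tIdeal ((algebraMapInv : FreeAlgebra K X →ₐ[K] K) : FreeAlgebra K X →+* K) hf
  have hbot : tIdeal K (m + 2) ≤ ⊥ := tIdeal_le fun a => by
    rw [TwoSidedIdeal.mem_bot, longComm, Ring.lie_def, mul_comm, sub_self]
  exact (TwoSidedIdeal.mem_bot K).1 (hbot h)

theorem algebraMap_mem_tIdeal {m : ℕ} (hmn : m + 2 ≤ n) {c : K}
    (hc : algebraMap K (relFreeRank K n r) c ∈ tIdeal (relFreeRank K n r) (m + 2)) : c = 0 := by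
  rw [← AlgHom.commutes (rankMap K n r), rankMap_mem_tIdeal_iff (by omega) hmn] at hc
  have := algebraMapInv_eq_zero_of_mem_tIdeal hc
  rwa [algebraMap_leftInverse] at this

/-- The elements of the rank `r` algebra with zero constant term lift to elements of the free
algebra with zero constant term. -/
theorem exists_of_mem_zeroConstIdeal {u : relFreeRank K n r} (hu : u ∈ zeroConstIdeal K n r) :
    ∃ f : FreeAlgebra K (Fin r), algebraMapInv f = (0 : K) ∧ rankMap K n r f = u := by
  induction hu using TwoSidedIdeal.span_induction with
  | mem u hu =>
    obtain ⟨i, hi, hu⟩ := hu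
    refine ⟨ι K ⟨i, hi⟩, by simp [algebraMapInv], ?_⟩
    rw [rankMap_ι]
    exact Subtype.ext hu.symm
  | zero => exact ⟨0, map_zero _, map_zero _⟩
  | add u v _ _ hu hv =>
    obtain ⟨f, hf, rfl⟩ := hu
    obtain ⟨g, hg, rfl⟩ := hv
    exact ⟨f + g, by rw [map_add, hf, hg, add_zero], map_add _ _ _⟩
  | neg u _ hu =>
    obtain ⟨f, hf, rfl⟩ := hu
    exact ⟨-f, by rw [map_neg, hf, neg_zero], map_neg _ _⟩
  | left_absorb a u _ hu =>
    obtain ⟨f, hf, rfl⟩ := hu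
    obtain ⟨g, rfl⟩ := rankMap_surjective a
    exact ⟨g * f, by rw [map_mul, hf, mul_zero], map_mul _ _ _⟩
  | right_absorb a u _ hu =>
    obtain ⟨f, hf, rfl⟩ := hu
    obtain ⟨g, rfl⟩ := rankMap_surjective a
    exact ⟨f * g, by rw [map_mul, hf, zero_mul], map_mul _ _ _⟩

theorem cardLeThree_fin (hr : r ≤ 3) : CardLeThree (Fin r) := by
  intro i j k l
  simp only [Fin.ext_iff]
  omega

variable [CharZero K]

theorem rankMap_mem_center_iff {m : ℕ} (hr : 2 ≤ r) (hr' : r ≤ 3) {f : FreeAlgebra K (Fin r)} :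
    rankMap K (m + 2) r f ∈ Subalgebra.center K (relFreeRank K (m + 2) r) ↔
      ∃ c : K, f - algebraMap K _ c ∈ tIdeal (FreeAlgebra K (Fin r)) (m + 1) := by
  have hX := cardLeThree_fin hr'
  have hlie : ∀ g, rankMap K (m + 2) r ⁅f, g⁆ = 0 ↔
      rankMap K (m + 2) r g * rankMap K (m + 2) r f =
        rankMap K (m + 2) r f * rankMap K (m + 2) r g := fun g => by
    rw [Ring.lie_def, map_sub, map_mul, map_mul, sub_eq_zero, eq_comm]
  constructor
  · intro h
    have h₁ : ∀ k, ⁅f, ι K k⁆ ∈ wtFiltration K (Fin r) (m + 1) := fun k =>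
      tIdeal_le_wtFiltration (rankMap_eq_zero_iff.1
        ((hlie _).2 (Subalgebra.mem_center_iff.1 h _)))
    have h01 : (⟨0, by omega⟩ : Fin r) ≠ ⟨1, by omega⟩ := by simp [Fin.ext_iff]
    obtain ⟨c, hc⟩ := exists_sub_algebraMap_mem_wtFiltration h01 h₁
    exact ⟨c, (mem_tIdeal_iff_mem_wtFiltration hX).2 hc⟩
  · rintro ⟨c, hc⟩
    rw [Subalgebra.mem_center_iff]
    intro b
    obtain ⟨g, rfl⟩ := rankMap_surjective b
    rw [← hlie, rankMap_eq_zero_iff]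
    convert lie_mem_tIdeal hX hc g using 1
    rw [Ring.lie_def, Ring.lie_def, sub_mul, mul_sub, Algebra.commutes]
    abel

theorem mem_center_iff {m : ℕ} (hr : 2 ≤ r) (hr' : r ≤ 3) (f : relFreeRank K (m + 2) r) :
    f ∈ Subalgebra.center K (relFreeRank K (m + 2) r) ↔
      ∃ c : K, ∃ g ∈ tIdeal (relFreeRank K (m + 2) r) (m + 1),
        f = algebraMap K (relFreeRank K (m + 2) r) c + g := by
  obtain ⟨f, rfl⟩ := rankMap_surjective f
  rw [rankMap_mem_center_iff hr hr']
  refine exists_congr fun c => ?_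
  rw [← rankMap_mem_tIdeal_iff (n := m + 2) (by omega) (by omega), map_sub, AlgHom.commutes]
  constructor
  · exact fun h => ⟨_, h, by rw [add_sub_cancel]⟩
  · rintro ⟨g, hg, h⟩
    rwa [h, add_sub_cancel_left]

end Transfer

theorem mainTheorem4 (K : Type*) [Field K] [CharZero K] (n r : ℕ) (hn : 3 ≤ n)
    (hr : r = 2 ∨ r = 3) :
    (∀ f : relFreeRank K n r, f ∈ Subalgebra.center K (relFreeRank K n r) ↔
        ∃ c : K, ∃ g ∈ tIdeal (relFreeRank K n r) (n - 1),
          f = algebraMap K (relFreeRank K n r) c + g) ∧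
      (∀ c : K, algebraMap K (relFreeRank K n r) c ∈ tIdeal (relFreeRank K n r) (n - 1) → c = 0) ∧
      (∀ f : relFreeRank K n r, f ∈ Subalgebra.center K (relFreeRank K n r) →
        f ∈ zeroConstIdeal K n r → IsNuclear K f) := by
  -- Here `n - 1 = m + 2` is at least two, so the augmentation kills `T⁽ⁿ⁻¹⁾` and the sum with the
  -- scalars is direct.
  obtain ⟨m, rfl⟩ : ∃ m, n = m + 1 + 2 := ⟨n - 3, by omega⟩
  have hr₂ : 2 ≤ r := by omega
  have hr₃ : r ≤ 3 := by omega
  have hcenter := mem_center_iff (K := K) (m := m + 1) hr₂ hr₃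
  refine ⟨hcenter, fun c => algebraMap_mem_tIdeal (by omega), fun f hf hf₀ b hb => ?_⟩
  obtain ⟨c, g, hg, rfl⟩ := (hcenter f).1 hf
  obtain ⟨p, hp, hpf⟩ := exists_of_mem_zeroConstIdeal hf₀
  have hmem : p - algebraMap K _ c ∈ tIdeal (FreeAlgebra K (Fin r)) (m + 2) := by
    rw [← rankMap_mem_tIdeal_iff (n := m + 1 + 2) (by omega) (by omega), map_sub, hpf,
      AlgHom.commutes, add_sub_cancel_left]
    exact hg
  -- Comparing constant terms gives `c = 0`; the element then lies in the ideal `T⁽ⁿ⁻¹⁾`, which is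
  -- central.
  have hc := algebraMapInv_eq_zero_of_mem_tIdeal hmem
  rw [map_sub, hp, FreeAlgebra.algebraMap_leftInverse, zero_sub, neg_eq_zero] at hc
  subst hc
  rw [map_zero, zero_add] at hb
  have hbT : b ∈ tIdeal (relFreeRank K (m + 1 + 2) r) (m + 2) :=
    TwoSidedIdeal.span_le.2 (Set.singleton_subset_iff.2 hg) hb
  exact (hcenter b).2 ⟨0, b, hbT, by rw [map_zero, zero_add]⟩
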